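/- Consider the single-user Gaussian optical intensity channel $Y=X+Z$, where the input $X\ge 0$ is independent of the noise $Z\sim\mathcal N(0,\sigma^2)$, $\sigma>0$. The input may be subject to a peak-intensity constraint $\Pr(X\le 1)=1$, to an average-intensity constraint $\mathbb E[X]\le\alpha$, or to both. Let $\log$ be the natural logarithm, $\mathcal Q(x)=\Pr(\mathcal N(0,1)>x)$, and $$R(u)=2\mathcal Q\left(\tfrac1u\right)\left(2+\tfrac{1}{2u^2}+\log(5+2u^2)+\log\left(1+\sqrt{\tfrac{9\pi}{2}}\,u\right)\right),\qquad u>0 .$$ For an integer $K\ge 1$ and $t\in(0,1)$ put $m_K(t)=K+\frac1t-\frac{K+1}{1-(1-t)^{K+1}}$ and, for $\alpha>0$, $$F_{K,\alpha}(t)=\log\frac{1-(1-t)^{K+1}}{t}-m_K(t)\log(1-t)-R\left(2\,m_K(t)\,\frac{\sigma}{\alpha}\right).$$ An equi-spaced discrete input $X_D$ is a random variable whose support is exactly $\{2lj : j=0,1,\dots,K\}$ for some spacing parameter $l>0$; for $K=\infty$ the support is $\{2lj: j=0,1,2,\dots\}$. (1) For every integer $K\ge1$ there is an equi-spaced input $X_D$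 with $K+1$ support points that satisfies the peak-intensity constraint and $$I(X_D;Y)\ge\log(K+1)-R(2K\sigma).$$ (2) For every integer $K\ge1$ and every $\alpha>0$ there is an equi-spaced input $X_D$ with $K+1$ support points that satisfies the average-intensity constraint and $$I(X_D;Y)\ge\sup_{t\in(0,1)}F_{K,\alpha}(t).$$ (3) For every integer $K\ge1$ and every $\alpha\in(0,\tfrac12)$ the equation $$\frac1\eta-\frac{K+1}{1-(1-\eta)^{K+1}}+(1-\alpha)K=0$$ has a unique solution $\eta\in(0,1)$, and there is an equi-spaced input $X_D$ with $K+1$ support points that satisfies both the peak- and the average-intensity constraint and $$I(X_D;Y)\ge\sup_{t\in(0,\eta)}F_{K,\alpha}(t).$$ (4) For $K=\infty$ and every $\alpha>0$ there is an equi-spaced input $X_D$ that satisfies the average-intensity constraint and $$I(X_D;Y)\ge\sup_{l\in(0,\infty)}\left\{\log\left(1+\frac{\alpha}{2l}\right)+\frac{\alpha}{2l}\log\left(1+\frac{2l}{\alpha}\right)-R\left(\frac{\sigma}{l}\right)\right\}.$$ -/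

import Mathlib

open MeasureTheory ProbabilityTheory Set

open scoped ENNReal

/-- The Gaussian tail function `Q(x) = Pr(N(0,1) > x)`. -/
noncomputable def gaussianQ (x : ℝ) : ℝ :=
  (gaussianReal 0 1).real (Ioi x)

/-- The bound function `R(u)`, used for `u > 0`. -/
noncomputable def gaussMixR (u : ℝ) : ℝ :=
  2 * gaussianQ (1 / u) *
    (2 + 1 / (2 * u ^ 2) + Real.log (5 + 2 * u ^ 2)
      + Real.log (1 + Real.sqrt (9 * Real.pi / 2) * u))

/-- Mutual information (in nats) of two random variables: the Kullback-Leibler divergence of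
their joint law from the product of their marginal laws. -/
noncomputable def mutualInfo {Ω 𝓧 𝓨 : Type*} [MeasurableSpace Ω] [MeasurableSpace 𝓧]
    [MeasurableSpace 𝓨] (P : Measure Ω) (X : Ω → 𝓧) (Y : Ω → 𝓨) : ℝ≥0∞ :=
  InformationTheory.klDiv (P.map fun ω => (X ω, Y ω)) ((P.map X).prod (P.map Y))

/-- `I(X; Y)` for the channel `Y = X + Z`, where `X` has law `μ` and `Z`, independent of `X`, is
Gaussian with mean `0` and variance `σ²`: on the product space, `X` is the first and `Z` the
second coordinate. -/
noncomputable def channelInfo (σ : ℝ) (μ : Measure ℝ) : ℝ≥0∞ :=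
  mutualInfo (μ.prod (gaussianReal 0 (σ ^ 2).toNNReal)) (fun p => p.1) (fun p => p.1 + p.2)

/-- The equi-spaced set `{2 l j : j = 0, 1, …, K}`, where `K = ∞` is allowed. -/
def equispacedSet (K : ℕ∞) (l : ℝ) : Set ℝ :=
  {x | ∃ j : ℕ, (j : ℕ∞) ≤ K ∧ x = 2 * l * j}

/-- `μ` is the law of a discrete random variable whose support is exactly
`{2 l j : j = 0, 1, …, K}` with `l > 0`. -/
structure IsEquispacedLaw (K : ℕ∞) (l : ℝ) (μ : Measure ℝ) : Prop where
  spacing_pos : 0 < l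
  isProbabilityMeasure : IsProbabilityMeasure μ
  null_compl : μ (equispacedSet K l)ᶜ = 0
  charges : ∀ x ∈ equispacedSet K l, 0 < μ {x}

/-- Nonnegativity of the optical intensity: `Pr(X ≥ 0) = 1`. -/
def NonnegIntensity (μ : Measure ℝ) : Prop :=
  ∀ᵐ x ∂μ, 0 ≤ x

/-- The peak-intensity constraint `Pr(X ≤ 1) = 1`. -/
def PeakConstraint (μ : Measure ℝ) : Prop :=
  ∀ᵐ x ∂μ, x ≤ 1

/-- The average-intensity constraint `E[X] ≤ α`, the expectation being finite. -/
def AverageConstraint (α : ℝ) (μ : Measure ℝ) : Prop :=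
  Integrable (fun x : ℝ => x) μ ∧ ∫ x, x ∂μ ≤ α

/-- `m_K(t) = K + 1/t - (K+1)/(1-(1-t)^(K+1))`, the mean of the truncated geometric distribution
with parameter `t` on `{0, …, K}`. -/
noncomputable def truncGeomMean (K : ℕ) (t : ℝ) : ℝ :=
  K + 1 / t - (K + 1) / (1 - (1 - t) ^ (K + 1))

/-- The expression `log((1-(1-t)^(K+1))/t) - m_K(t) log(1-t) - R(2 m_K(t) σ/α)`. -/
noncomputable def truncGeomBound (K : ℕ) (α σ t : ℝ) : ℝ :=
  Real.log ((1 - (1 - t) ^ (K + 1)) / t) - truncGeomMean K t * Real.log (1 - t)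
    - gaussMixR (2 * truncGeomMean K t * (σ / α))

/-- The expression `log(1+α/(2l)) + (α/(2l)) log(1+2l/α) - R(σ/l)`. -/
noncomputable def geomBound (α σ l : ℝ) : ℝ :=
  Real.log (1 + α / (2 * l)) + α / (2 * l) * Real.log (1 + 2 * l / α) - gaussMixR (σ / l)

/-- The equation `1/η - (K+1)/(1-(1-η)^(K+1)) + (1-α) K = 0`. -/
def EtaEquation (K : ℕ) (α η : ℝ) : Prop :=
  1 / η - (K + 1) / (1 - (1 - η) ^ (K + 1)) + (1 - α) * K = 0

/-! Measure the noise in units of σ, so that the lattice has spacing 2x with x = l/σ. As a surrogate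
posterior for the lattice point given Y, take the Gaussian kernel divided by its periodisation over
all of 2xℤ. Its sum over the support is at most 1 for every y, so the Donsker-Varadhan inequality
gives I(X;Y) ≥ H(X) − E[`decodeCost` x N] with N standard normal, and the law of Y never has to be
computed (`le_channelInfo`, `le_channelInfo_latticeLaw`).

The expected cost is at most R(1/x) (`integral_decodeCost_le`). On the central cell, log z ≤ z − 1
and the disjointness of the translated cells leave 2Q(x); outside it, a tail second moment and a
uniform bound on the periodisation suffice.

Geometric weights q^j, with q = 1 − t, have an explicit entropy, and l = α/(2·mean index) makes E[X]
= α. A single input has to dominate a whole supremum, so the supremum must be attained. This follows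
from continuity and compactness once the bound is controlled at the ends of the parameter range; if
the bound is never positive, any admissible input works because information is nonnegative. Under
both constraints, strict monotonicity of the mean index in q (`strictMonoOn_geomMean`) gives the
unique η and turns t < η into the peak constraint. -/

/-! ### Periodised Gaussian. -/

lemma hasSum_int_one_div_sq :
    HasSum (fun k : ℤ => 1 / (k : ℝ) ^ 2) (Real.pi ^ 2 / 3) := by
  have h1 := hasSum_zeta_two
  have h := HasSum.of_nat_of_neg (f := fun k : ℤ => 1 / (k : ℝ) ^ 2)
    (g := Real.pi ^ 2 / 6) (g' := Real.pi ^ 2 / 6) (by simpa using h1) (by simpa using h1)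
  -- The term k = 0 is 1/0 = 0.
  have h2 : Real.pi ^ 2 / 6 + Real.pi ^ 2 / 6 - 1 / ((0 : ℤ) : ℝ) ^ 2 = Real.pi ^ 2 / 3 := by
    norm_num
    ring
  rwa [h2] at h

/-- The Gaussian function periodised along `2 x ℤ`. -/
noncomputable def gaussTheta (x n : ℝ) : ℝ := ∑' k : ℤ, Real.exp (-(n - 2 * x * k) ^ 2 / 2)

/-- For k ≠ 0, |n − 2xk| ≥ 2x|k| − x ≥ x|k|, and exp(−s) ≤ 1/s. The `if` supplies the term k = 0,
where 1/k² evaluates to 0. -/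
lemma exp_neg_sq_le_of_abs_le {x n : ℝ} (hx : 0 < x) (hn : |n| ≤ x) (k : ℤ) :
    Real.exp (-(n - 2 * x * k) ^ 2 / 2) ≤
      2 / x ^ 2 * (1 / (k : ℝ) ^ 2) + if k = 0 then 1 else 0 := by
  by_cases hk : k = 0
  · subst hk
    have : 0 ≤ 2 / x ^ 2 * (1 / ((0 : ℤ) : ℝ) ^ 2) := by positivity
    have h2 : Real.exp (-(n - 2 * x * (0 : ℤ)) ^ 2 / 2) ≤ 1 :=
      Real.exp_le_one_iff.2 (by nlinarith [sq_nonneg (n - 2 * x * (0 : ℤ))])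
    simpa using h2
  · simp only [hk, if_false, add_zero]
    have hk1 : (1 : ℝ) ≤ |(k : ℝ)| := by
      exact_mod_cast Int.one_le_abs hk
    have h1 : x * |(k : ℝ)| ≤ |n - 2 * x * k| := by
      have h2 := abs_sub_abs_le_abs_sub (2 * x * k) n
      rw [abs_sub_comm, abs_mul, abs_of_pos (by positivity : 0 < 2 * x)] at h2
      nlinarith
    have h3 : x ^ 2 * (k : ℝ) ^ 2 ≤ (n - 2 * x * k) ^ 2 := by
      have := pow_le_pow_left₀ (by positivity) h1 2
      rwa [mul_pow, sq_abs, sq_abs] at this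
    have hk0 : (k : ℝ) ≠ 0 := by exact_mod_cast hk
    have hp : 0 < x ^ 2 * (k : ℝ) ^ 2 := by positivity
    have h4 : Real.exp (-(n - 2 * x * k) ^ 2 / 2) ≤ Real.exp (-(x ^ 2 * (k : ℝ) ^ 2 / 2)) :=
      Real.exp_le_exp.2 (by linarith)
    refine h4.trans ?_
    rw [Real.exp_neg]
    have h5 := Real.add_one_le_exp (x ^ 2 * (k : ℝ) ^ 2 / 2)
    calc (Real.exp (x ^ 2 * (k : ℝ) ^ 2 / 2))⁻¹ ≤ (x ^ 2 * (k : ℝ) ^ 2 / 2)⁻¹ :=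
          inv_anti₀ (by positivity) (by linarith)
      _ = _ := by field_simp

lemma hasSum_majorant (x : ℝ) :
    HasSum (fun k : ℤ => 2 / x ^ 2 * (1 / (k : ℝ) ^ 2) + if k = 0 then 1 else 0)
      (2 / x ^ 2 * (Real.pi ^ 2 / 3) + 1) :=
  (hasSum_int_one_div_sq.mul_left _).add (hasSum_ite_eq 0 1)

lemma exists_shift {x : ℝ} (hx : 0 < x) (n : ℝ) : ∃ m : ℤ, |n - 2 * x * m| ≤ x := by
  refine ⟨round (n / (2 * x)), ?_⟩
  have h := abs_sub_round (n / (2 * x))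
  have h2 : n - 2 * x * round (n / (2 * x)) = 2 * x * (n / (2 * x) - round (n / (2 * x))) := by
    field_simp
  rw [h2, abs_mul, abs_of_pos (by positivity)]
  nlinarith

lemma summable_gaussTheta {x : ℝ} (hx : 0 < x) (n : ℝ) :
    Summable fun k : ℤ => Real.exp (-(n - 2 * x * k) ^ 2 / 2) := by
  obtain ⟨m, hm⟩ := exists_shift hx n
  rw [← (Equiv.addRight m).summable_iff]
  refine Summable.of_nonneg_of_le (fun _ => (Real.exp_pos _).le) (fun k => ?_)
    (hasSum_majorant x).summable
  refine le_of_eq_of_le ?_ (exp_neg_sq_le_of_abs_le hx hm k)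
  simp only [Function.comp_apply, Equiv.coe_addRight, Int.cast_add]
  ring_nf

lemma gaussTheta_add {x : ℝ} (n : ℝ) (m : ℤ) :
    gaussTheta x (n - 2 * x * m) = gaussTheta x n := by
  unfold gaussTheta
  rw [← (Equiv.addRight m).tsum_eq (fun k : ℤ => Real.exp (-(n - 2 * x * k) ^ 2 / 2))]
  refine tsum_congr fun k => ?_
  simp only [Equiv.coe_addRight, Int.cast_add]
  ring_nf

lemma gaussTheta_le {x : ℝ} (hx : 0 < x) (n : ℝ) :
    gaussTheta x n ≤ 2 / x ^ 2 * (Real.pi ^ 2 / 3) + 1 := by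
  obtain ⟨m, hm⟩ := exists_shift hx n
  rw [← gaussTheta_add n m]
  exact (summable_gaussTheta hx _).tsum_le_of_sum_le (fun s =>
    (Finset.sum_le_sum fun k _ => exp_neg_sq_le_of_abs_le hx hm k).trans
      (sum_le_hasSum s (fun k _ => by positivity) (hasSum_majorant x)))

lemma exp_le_gaussTheta {x : ℝ} (hx : 0 < x) (n : ℝ) (k : ℤ) :
    Real.exp (-(n - 2 * x * k) ^ 2 / 2) ≤ gaussTheta x n :=
  (summable_gaussTheta hx n).le_tsum k fun _ _ => (Real.exp_pos _).le

lemma gaussTheta_pos {x : ℝ} (hx : 0 < x) (n : ℝ) : 0 < gaussTheta x n :=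
  (Real.exp_pos _).trans_le (exp_le_gaussTheta hx n 0)

lemma measurable_gaussTheta {x : ℝ} : Measurable (gaussTheta x) := by
  unfold gaussTheta
  fun_prop

/-- With u = 1/x, √(9π/2) ≥ 3 and π² ≤ 10 reduce the claim to 1 + (20/3)u² ≤ (5 + 2u²)(1 + 3u); the
crude bound on the periodisation thus already fits under the two logarithms of R. -/
lemma log_gaussTheta_le {x : ℝ} (hx : 0 < x) (n : ℝ) :
    Real.log (gaussTheta x n) ≤
      Real.log (5 + 2 * (1 / x) ^ 2) + Real.log (1 + Real.sqrt (9 * Real.pi / 2) * (1 / x)) := by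
  have hs : 3 ≤ Real.sqrt (9 * Real.pi / 2) :=
    Real.le_sqrt_of_sq_le (by nlinarith [Real.pi_gt_three])
  have hu : 0 < 1 / x := by positivity
  rw [← Real.log_mul (by positivity) (by positivity)]
  refine Real.log_le_log (gaussTheta_pos hx n) ((gaussTheta_le hx n).trans ?_)
  have hpi : Real.pi ^ 2 ≤ 10 := by nlinarith [Real.pi_lt_d2, Real.pi_pos]
  set u := 1 / x with hu'
  have h1 : 2 / x ^ 2 = 2 * u ^ 2 := by rw [hu']; ring
  rw [h1]
  have h2 : (5 + 2 * u ^ 2) * (1 + 3 * u) ≤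
      (5 + 2 * u ^ 2) * (1 + Real.sqrt (9 * Real.pi / 2) * u) := by gcongr
  refine le_trans ?_ h2
  have h3 : 2 * u ^ 2 * (Real.pi ^ 2 / 3) ≤ 2 * u ^ 2 * (10 / 3) := by gcongr
  nlinarith [mul_pos hu hu, mul_nonneg hu.le (sq_nonneg (u - 1))]

/-! ### Expected decoding cost. -/

/-- `-log` of the Gaussian function normalised by its periodisation. -/
noncomputable def decodeCost (x n : ℝ) : ℝ := n ^ 2 / 2 + Real.log (gaussTheta x n)

lemma measurable_decodeCost {x : ℝ} : Measurable (decodeCost x) := by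
  unfold decodeCost
  have := measurable_gaussTheta (x := x)
  fun_prop

lemma decodeCost_nonneg {x : ℝ} (hx : 0 < x) (n : ℝ) : 0 ≤ decodeCost x n := by
  have h := Real.log_le_log (Real.exp_pos _) (exp_le_gaussTheta hx n 0)
  rw [Real.log_exp] at h
  simp at h
  unfold decodeCost
  linarith

lemma integrable_sq_gaussian : Integrable (fun n : ℝ => n ^ 2) (gaussianReal 0 1) :=
  (memLp_id_gaussianReal' 2 (by simp)).integrable_sq

lemma integrable_decodeCost {x : ℝ} (hx : 0 < x) :
    Integrable (decodeCost x) (gaussianReal 0 1) := by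
  refine Integrable.mono' ((integrable_sq_gaussian.div_const 2).add (integrable_const
    (Real.log (5 + 2 * (1 / x) ^ 2) + Real.log (1 + Real.sqrt (9 * Real.pi / 2) * (1 / x)))))
    measurable_decodeCost.aestronglyMeasurable (Filter.Eventually.of_forall fun n => ?_)
  rw [Real.norm_of_nonneg (decodeCost_nonneg hx n)]
  have := log_gaussTheta_le hx n
  simp only [decodeCost, Pi.add_apply]
  linarith

lemma gaussianPDFReal_mul_exp (n y : ℝ) :
    gaussianPDFReal 0 1 n * (Real.exp (n ^ 2 / 2) * Real.exp (-(n - y) ^ 2 / 2)) =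
      gaussianPDFReal y 1 n := by
  simp only [gaussianPDFReal]
  rw [mul_assoc, ← Real.exp_add, ← Real.exp_add]
  congr 2
  simp
  ring

/-- Against the standard density, the k-th term becomes the density of N(2xk, 1). Its mass on the
central cell is the standard Gaussian mass of the cell shifted by −2xk, and these cells are
disjoint. -/
lemma lintegral_exp_mul_gaussTheta_le {x : ℝ} (hx : 0 < x) :
    ∫⁻ n in Ioc (-x) x, ENNReal.ofReal (Real.exp (n ^ 2 / 2) * gaussTheta x n)
      ∂(gaussianReal 0 1) ≤ 1 := by
  have h1 : ∀ n, ENNReal.ofReal (Real.exp (n ^ 2 / 2) * gaussTheta x n) =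
      ∑' k : ℤ, ENNReal.ofReal (Real.exp (n ^ 2 / 2) * Real.exp (-(n - 2 * x * k) ^ 2 / 2)) := by
    intro n
    rw [← ENNReal.ofReal_tsum_of_nonneg (fun k => by positivity)
      ((summable_gaussTheta hx n).mul_left _), tsum_mul_left, gaussTheta]
  have h2 : ∀ k : ℤ, ∫⁻ n in Ioc (-x) x,
      ENNReal.ofReal (Real.exp (n ^ 2 / 2) * Real.exp (-(n - 2 * x * k) ^ 2 / 2))
        ∂(gaussianReal 0 1) =
      gaussianReal 0 1 (Ioc (-x + (-k) • (2 * x)) (-x + (-k + 1) • (2 * x))) := by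
    intro k
    have hz := gaussianReal_map_add_const (μ := 0) (v := 1) (2 * x * k)
    rw [gaussianReal_of_var_ne_zero 0 one_ne_zero, restrict_withDensity measurableSet_Ioc,
      lintegral_withDensity_eq_lintegral_mul _ (measurable_gaussianPDF 0 1) (by fun_prop),
      ← gaussianReal_of_var_ne_zero 0 one_ne_zero]
    have h3 : ∀ n, (gaussianPDF 0 1 * fun n => ENNReal.ofReal (Real.exp (n ^ 2 / 2) *
        Real.exp (-(n - 2 * x * k) ^ 2 / 2))) n = gaussianPDF (2 * x * k) 1 n := by
      intro n
      simp only [Pi.mul_apply, gaussianPDF]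
      rw [← ENNReal.ofReal_mul (gaussianPDFReal_nonneg _ _ _), gaussianPDFReal_mul_exp]
    simp_rw [h3]
    rw [← gaussianReal_apply _ one_ne_zero]
    rw [zero_add] at hz
    rw [← hz, Measure.map_apply (by fun_prop) measurableSet_Ioc]
    congr 1
    ext y
    simp only [mem_preimage, mem_Ioc, zsmul_eq_mul]
    push_cast
    constructor <;> rintro ⟨a, b⟩ <;> constructor <;> linarith
  simp_rw [h1]
  rw [lintegral_tsum (fun k => by fun_prop)]
  simp_rw [h2]
  rw [← measure_iUnion]
  · exact prob_le_one
  · exact (pairwise_disjoint_Ioc_add_zsmul (-x) (2 * x)).comp_of_injective neg_injective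
  · exact fun _ => measurableSet_Ioc

lemma gaussianQ_nonneg (x : ℝ) : 0 ≤ gaussianQ x := measureReal_nonneg

instance : NullSingletonClass (gaussianReal 0 1) :=
  nullSingletonClass_gaussianReal one_ne_zero

lemma gaussianReal_Iic_neg (x : ℝ) : (gaussianReal 0 1).real (Iic (-x)) = gaussianQ x := by
  have h := gaussianReal_map_neg (μ := 0) (v := 1)
  rw [neg_zero] at h
  rw [← h, measureReal_def, Measure.map_apply (by fun_prop) measurableSet_Iic]
  have : (fun x : ℝ => -x) ⁻¹' Iic (-x) = Ici x := by ext; simp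
  rw [this, gaussianQ, measureReal_def, measure_congr Ioi_ae_eq_Ici]

lemma compl_Ioc_eq (x : ℝ) : (Ioc (-x) x)ᶜ = Iic (-x) ∪ Ioi x := by
  ext y
  simp only [mem_compl_iff, mem_Ioc, mem_union, mem_Iic, mem_Ioi, not_and_or, not_lt, not_le]

lemma gaussianReal_compl_Ioc {x : ℝ} (hx : 0 < x) :
    (gaussianReal 0 1).real (Ioc (-x) x)ᶜ = 2 * gaussianQ x := by
  rw [compl_Ioc_eq x, measureReal_union ?_ measurableSet_Ioi, gaussianReal_Iic_neg, gaussianQ]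
  · ring
  · rw [Set.disjoint_left]
    intro y h1 h2
    simp at h1 h2
    linarith

lemma integrable_gaussian_iff (f : ℝ → ℝ) :
    Integrable f (gaussianReal 0 1) ↔ Integrable fun n => gaussianPDFReal 0 1 n * f n := by
  rw [gaussianReal_of_var_ne_zero 0 one_ne_zero,
    integrable_withDensity_iff_integrable_smul' (measurable_gaussianPDF 0 1)
      (Filter.Eventually.of_forall fun _ => gaussianPDF_lt_top)]
  simp [toReal_gaussianPDF]

lemma setIntegral_gaussian (f : ℝ → ℝ) {s : Set ℝ} (hs : MeasurableSet s) :
    ∫ n in s, f n ∂(gaussianReal 0 1) = ∫ n in s, gaussianPDFReal 0 1 n * f n := by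
  rw [← integral_indicator hs, integral_gaussianReal_eq_integral_smul one_ne_zero,
    ← integral_indicator hs]
  congr 1
  ext n
  by_cases hn : n ∈ s <;> simp [hn]

lemma hasDerivAt_gaussianPDFReal (n : ℝ) :
    HasDerivAt (gaussianPDFReal 0 1) (-n * gaussianPDFReal 0 1 n) n := by
  have h : HasDerivAt (fun n : ℝ => -(n - 0) ^ 2 / (2 * ((1 : NNReal) : ℝ))) (-n) n := by
    have h1 := ((hasDerivAt_id n).sub_const 0).fun_pow 2 |>.fun_neg.div_const
      (2 * ((1 : NNReal) : ℝ))
    refine h1.congr_deriv ?_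
    simp
    ring
  have h2 := h.exp.const_mul (Real.sqrt (2 * Real.pi * (1 : NNReal)))⁻¹
  refine h2.congr_deriv ?_
  simp only [gaussianPDFReal]
  ring

lemma mul_gaussianPDFReal_le {n : ℝ} (hn : 0 < n) : n * gaussianPDFReal 0 1 n ≤ 2 / n := by
  have h1 : (Real.sqrt (2 * Real.pi))⁻¹ ≤ 1 := by
    apply inv_le_one_of_one_le₀
    exact Real.one_le_sqrt.2 (by nlinarith [Real.pi_gt_three])
  have h2 : Real.exp (-n ^ 2 / 2) ≤ 2 / n ^ 2 := by
    rw [neg_div, Real.exp_neg]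
    calc (Real.exp (n ^ 2 / 2))⁻¹ ≤ (n ^ 2 / 2)⁻¹ :=
          inv_anti₀ (by positivity) (by linarith [Real.add_one_le_exp (n ^ 2 / 2)])
      _ = _ := by field_simp
  have h3 : gaussianPDFReal 0 1 n ≤ 1 * (2 / n ^ 2) := by
    have h4 : gaussianPDFReal 0 1 n = (Real.sqrt (2 * Real.pi))⁻¹ * Real.exp (-n ^ 2 / 2) := by
      simp [gaussianPDFReal]
    rw [h4]
    gcongr
  calc n * gaussianPDFReal 0 1 n ≤ n * (1 * (2 / n ^ 2)) := by gcongr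
    _ = 2 / n := by field_simp

/-- This primitive vanishes both at n = x and at infinity, so its derivative integrates to 0 over
the tail; there x²/n² ≤ 1, which yields the constant 2 + x² in `setIntegral_sq_Ioi_le`. -/
lemma hasDerivAt_tail_primitive (x : ℝ) {n : ℝ} (hn : 0 < n) :
    HasDerivAt (fun n => -(n - x ^ 2 / n) * gaussianPDFReal 0 1 n)
      (gaussianPDFReal 0 1 n * (n ^ 2 - x ^ 2 - 1 - x ^ 2 / n ^ 2)) n := by
  have h1 : HasDerivAt (fun n : ℝ => -(n - x ^ 2 / n)) (-(1 + x ^ 2 / n ^ 2)) n := by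
    have h2 := ((hasDerivAt_id' n).fun_sub (((hasDerivAt_inv hn.ne').const_mul (x ^ 2)))).fun_neg
    refine h2.congr_deriv ?_
    field_simp
    ring
  refine (h1.mul (hasDerivAt_gaussianPDFReal n)).congr_deriv ?_
  field_simp
  ring

lemma setIntegral_sq_Ioi_le {x : ℝ} (hx : 0 < x) :
    ∫ n in Ioi x, n ^ 2 ∂(gaussianReal 0 1) ≤ (2 + x ^ 2) * gaussianQ x := by
  have hb : ∀ n ∈ Ioi x, 0 ≤ x ^ 2 / n ^ 2 ∧ x ^ 2 / n ^ 2 ≤ 1 := by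
    intro n hn
    have hn0 : 0 < n := hx.trans hn
    refine ⟨by positivity, (div_le_one (by positivity)).2 ?_⟩
    have : x < n := hn
    gcongr
  have hint : IntegrableOn (fun n : ℝ => n ^ 2 - x ^ 2 - 1 - x ^ 2 / n ^ 2) (Ioi x)
      (gaussianReal 0 1) := by
    refine Integrable.sub (Integrable.sub (Integrable.sub integrable_sq_gaussian.integrableOn
      (integrable_const _)) (integrable_const _)) ?_
    refine Integrable.mono' (integrable_const (1 : ℝ))
      (Measurable.aestronglyMeasurable (by fun_prop)) ?_
    refine (ae_restrict_mem measurableSet_Ioi).mono fun n hn => ?_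
    rw [Real.norm_of_nonneg (hb n hn).1]
    exact (hb n hn).2
  have hint2 : IntegrableOn (fun n : ℝ => gaussianPDFReal 0 1 n *
      (n ^ 2 - x ^ 2 - 1 - x ^ 2 / n ^ 2)) (Ioi x) := by
    rw [← integrable_indicator_iff measurableSet_Ioi] at hint ⊢
    rw [integrable_gaussian_iff] at hint
    refine hint.congr (Filter.Eventually.of_forall fun n => ?_)
    by_cases hn : n ∈ Ioi x <;> simp [hn]
  have hlim : Filter.Tendsto (fun n => -(n - x ^ 2 / n) * gaussianPDFReal 0 1 n)
      Filter.atTop (nhds 0) := by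
    have h0 : Filter.Tendsto (fun n : ℝ => 2 / n) Filter.atTop (nhds 0) :=
      Filter.Tendsto.const_div_atTop Filter.tendsto_id 2
    refine squeeze_zero_norm' ?_ h0
    filter_upwards [Filter.Ioi_mem_atTop x] with n hn
    have hn0 : 0 < n := hx.trans hn
    have hp := gaussianPDFReal_nonneg 0 1 n
    have h1 : 0 ≤ n - x ^ 2 / n := by
      rw [sub_nonneg, div_le_iff₀ hn0]
      have : x < n := hn
      nlinarith
    rw [neg_mul, norm_neg, Real.norm_of_nonneg (mul_nonneg h1 hp)]
    refine le_trans ?_ (mul_gaussianPDFReal_le hn0)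
    have : 0 ≤ x ^ 2 / n := by positivity
    nlinarith
  have hF := integral_Ioi_of_hasDerivAt_of_tendsto'
    (fun n hn => hasDerivAt_tail_primitive x (hx.trans_le hn)) hint2 hlim
  rw [← setIntegral_gaussian _ measurableSet_Ioi] at hF
  have h0 : x - x ^ 2 / x = 0 := by field_simp; ring
  rw [h0] at hF
  have hle : ∫ n in Ioi x, (n ^ 2 - (2 + x ^ 2)) ∂(gaussianReal 0 1) ≤
      ∫ n in Ioi x, (n ^ 2 - x ^ 2 - 1 - x ^ 2 / n ^ 2) ∂(gaussianReal 0 1) := by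
    refine setIntegral_mono_on (integrable_sq_gaussian.integrableOn.sub (integrable_const _)) hint
      measurableSet_Ioi fun n hn => ?_
    linarith [(hb n hn).2]
  rw [hF, integral_sub integrable_sq_gaussian.integrableOn (integrable_const _)] at hle
  simp only [integral_const, smul_eq_mul, measureReal_restrict_apply_univ] at hle
  change _ - gaussianQ x * _ ≤ _ at hle
  linarith

lemma setIntegral_sq_Iic_neg (x : ℝ) :
    ∫ n in Iic (-x), n ^ 2 ∂(gaussianReal 0 1) = ∫ n in Ioi x, n ^ 2 ∂(gaussianReal 0 1) := by
  have h := gaussianReal_map_neg (μ := 0) (v := 1)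
  rw [neg_zero] at h
  conv_lhs => rw [← h]
  rw [setIntegral_map measurableSet_Iic (by fun_prop) (by fun_prop)]
  have : (fun x : ℝ => -x) ⁻¹' Iic (-x) = Ici x := by ext; simp
  rw [this, setIntegral_congr_set Ioi_ae_eq_Ici]
  simp

lemma setIntegral_sq_compl_le {x : ℝ} (hx : 0 < x) :
    ∫ n in (Ioc (-x) x)ᶜ, n ^ 2 ∂(gaussianReal 0 1) ≤ 2 * ((2 + x ^ 2) * gaussianQ x) := by
  rw [compl_Ioc_eq x, setIntegral_union ?_ measurableSet_Ioi integrable_sq_gaussian.integrableOn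
    integrable_sq_gaussian.integrableOn, setIntegral_sq_Iic_neg]
  · linarith [setIntegral_sq_Ioi_le hx]
  · rw [Set.disjoint_left]
    intro y h1 h2
    simp at h1 h2
    linarith

/-- The cost is log z with z = exp(n²/2)·θ(n). Bounding it by z − 1 gives at most 1 minus the mass
of the cell. -/
lemma setIntegral_decodeCost_Ioc_le {x : ℝ} (hx : 0 < x) :
    ∫ n in Ioc (-x) x, decodeCost x n ∂(gaussianReal 0 1) ≤ 2 * gaussianQ x := by
  have hE : ∀ n, 0 ≤ Real.exp (n ^ 2 / 2) * gaussTheta x n := fun n =>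
    mul_nonneg (Real.exp_pos _).le (gaussTheta_pos hx n).le
  have hm : Measurable fun n => Real.exp (n ^ 2 / 2) * gaussTheta x n := by
    have := measurable_gaussTheta (x := x)
    fun_prop
  have hl := lintegral_exp_mul_gaussTheta_le hx
  have hint : IntegrableOn (fun n => Real.exp (n ^ 2 / 2) * gaussTheta x n) (Ioc (-x) x)
      (gaussianReal 0 1) := by
    refine ⟨hm.aestronglyMeasurable, ?_⟩
    rw [hasFiniteIntegral_iff_ofReal (Filter.Eventually.of_forall hE)]
    exact hl.trans_lt ENNReal.one_lt_top
  have hI : ∫ n in Ioc (-x) x, Real.exp (n ^ 2 / 2) * gaussTheta x n ∂(gaussianReal 0 1) ≤ 1 := by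
    rw [integral_eq_lintegral_of_nonneg_ae (Filter.Eventually.of_forall hE)
      hm.aestronglyMeasurable]
    exact ENNReal.toReal_le_of_le_ofReal zero_le_one (by simpa using hl)
  have hle : ∫ n in Ioc (-x) x, decodeCost x n ∂(gaussianReal 0 1) ≤
      ∫ n in Ioc (-x) x, (Real.exp (n ^ 2 / 2) * gaussTheta x n - 1) ∂(gaussianReal 0 1) := by
    refine integral_mono (integrable_decodeCost hx).integrableOn
      (hint.sub (integrable_const _)) fun n => ?_
    have h := Real.log_le_sub_one_of_pos (mul_pos (Real.exp_pos (n ^ 2 / 2)) (gaussTheta_pos hx n))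
    rw [Real.log_mul (Real.exp_pos _).ne' (gaussTheta_pos hx n).ne', Real.log_exp] at h
    exact h
  rw [integral_sub hint (integrable_const _)] at hle
  simp only [integral_const, smul_eq_mul, measureReal_restrict_apply_univ, mul_one] at hle
  have hc := probReal_compl_eq_one_sub (μ := gaussianReal 0 1)
    (measurableSet_Ioc (a := -x) (b := x))
  rw [gaussianReal_compl_Ioc hx] at hc
  linarith

lemma integral_decodeCost_le {x : ℝ} (hx : 0 < x) :
    ∫ n, decodeCost x n ∂(gaussianReal 0 1) ≤ gaussMixR (1 / x) := by
  rw [← integral_add_compl (measurableSet_Ioc (a := -x) (b := x)) (integrable_decodeCost hx)]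
  set B := Real.log (5 + 2 * (1 / x) ^ 2) + Real.log (1 + Real.sqrt (9 * Real.pi / 2) * (1 / x))
    with hB
  have h1 : ∫ n in (Ioc (-x) x)ᶜ, decodeCost x n ∂(gaussianReal 0 1) ≤
      ∫ n in (Ioc (-x) x)ᶜ, (n ^ 2 / 2 + B) ∂(gaussianReal 0 1) := by
    refine integral_mono (integrable_decodeCost hx).integrableOn
      ((integrable_sq_gaussian.div_const 2).integrableOn.add (integrable_const _)) fun n => ?_
    have := log_gaussTheta_le hx n
    simp only [decodeCost]
    linarith
  rw [integral_add (integrable_sq_gaussian.div_const 2).integrableOn (integrable_const _),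
    integral_div] at h1
  simp only [integral_const, smul_eq_mul, measureReal_restrict_apply_univ,
    gaussianReal_compl_Ioc hx] at h1
  have h2 := setIntegral_sq_compl_le hx
  have h3 := setIntegral_decodeCost_Ioc_le hx
  have h4 : gaussMixR (1 / x) = 2 * gaussianQ x * (2 + x ^ 2 / 2 + B) := by
    rw [gaussMixR, hB, one_div_one_div]
    have : 1 / (2 * (1 / x) ^ 2) = x ^ 2 / 2 := by field_simp
    rw [this]
    ring
  rw [h4]
  linarith

/-! ### Variational lower bound for the information. -/

/-- A Donsker-Varadhan type lower bound for the Kullback-Leibler divergence. -/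
lemma integral_le_klDiv {α : Type*} [MeasurableSpace α] {P Q : Measure α}
    [IsProbabilityMeasure P] [IsProbabilityMeasure Q] {f : α → ℝ} (hfm : Measurable f)
    (hf : Integrable f P) (hexp : ∫⁻ a, ENNReal.ofReal (Real.exp (f a)) ∂Q ≤ 1) :
    ((∫ a, f a ∂P : ℝ) : EReal) ≤ (InformationTheory.klDiv P Q : EReal) := by
  by_cases hac : P ≪ Q
  swap
  · rw [InformationTheory.klDiv_of_not_ac hac]; simp
  by_cases hllr : Integrable (llr P Q) P
  swap
  · rw [InformationTheory.klDiv_of_not_integrable hllr]; simp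
  -- Change of measure to Q: the density cancels exp(−llr), and points where it vanishes contribute
  -- 0.
  have hle : ∫⁻ a, ENNReal.ofReal (Real.exp (f a - llr P Q a)) ∂P ≤ 1 := by
    rw [← lintegral_rnDeriv_mul hac (by fun_prop)]
    refine le_trans (lintegral_mono_ae ?_) hexp
    filter_upwards [Measure.rnDeriv_lt_top P Q] with a ha
    by_cases h0 : P.rnDeriv Q a = 0
    · simp [h0]
    · have hpos : 0 < (P.rnDeriv Q a).toReal := ENNReal.toReal_pos h0 ha.ne
      rw [Real.exp_sub, llr_def, Real.exp_log hpos]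
      nth_rewrite 1 [← ENNReal.ofReal_toReal ha.ne]
      rw [← ENNReal.ofReal_mul hpos.le, mul_div_cancel₀ _ hpos.ne']
  have hpos : ∀ a, 0 ≤ Real.exp (f a - llr P Q a) := fun a => (Real.exp_pos _).le
  have hm : Measurable fun a => Real.exp (f a - llr P Q a) := by
    have := measurable_llr P Q
    fun_prop
  have hint : Integrable (fun a => Real.exp (f a - llr P Q a)) P := by
    refine ⟨hm.aestronglyMeasurable, ?_⟩
    rw [hasFiniteIntegral_iff_ofReal (Filter.Eventually.of_forall hpos)]
    exact hle.trans_lt ENNReal.one_lt_top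
  have hI : ∫ a, Real.exp (f a - llr P Q a) ∂P ≤ 1 := by
    rw [integral_eq_lintegral_of_nonneg_ae (Filter.Eventually.of_forall hpos)
      hm.aestronglyMeasurable]
    exact ENNReal.toReal_le_of_le_ofReal zero_le_one (by simpa using hle)
  have hmono : ∫ a, (f a - llr P Q a) ∂P ≤ ∫ a, (Real.exp (f a - llr P Q a) - 1) ∂P := by
    refine integral_mono (hf.sub hllr) (hint.sub (integrable_const _)) fun a => ?_
    have := Real.add_one_le_exp (f a - llr P Q a)
    simp only
    linarith
  rw [integral_sub hf hllr, integral_sub hint (integrable_const _)] at hmono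
  have hkl := InformationTheory.toReal_klDiv_of_measure_eq hac (by simp)
  rw [← EReal.coe_ennreal_toReal (InformationTheory.klDiv_ne_top hac hllr), hkl]
  simp at hmono
  exact_mod_cast by linarith

lemma gaussianReal_eq_map (σ : ℝ) :
    gaussianReal 0 (σ ^ 2).toNNReal = (gaussianReal 0 1).map (fun n => σ * n) := by
  rw [gaussianReal_map_const_mul]
  congr 1
  · simp
  · ext
    simp [sq_nonneg]

/-- The test function is a + bx − cost((y − x)/σ). Hypothesis `h` normalises it for each y
separately, so any law of Y is allowed; under the joint law y − x is the noise, and the cost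
averages to at most R(σ/l). -/
lemma le_channelInfo {σ l : ℝ} (hσ : 0 < σ) (hl : 0 < l) (μ : Measure ℝ)
    [IsProbabilityMeasure μ] (hμ : Integrable (fun x => x) μ) (a b : ℝ)
    (h : ∀ y, ∫⁻ x, ENNReal.ofReal
      (Real.exp (a + b * x - decodeCost (l / σ) ((y - x) / σ))) ∂μ ≤ 1) :
    ((a + b * ∫ x, x ∂μ - gaussMixR (σ / l) : ℝ) : EReal) ≤ (channelInfo σ μ : EReal) := by
  have hx : 0 < l / σ := by positivity
  set γ := gaussianReal 0 (σ ^ 2).toNNReal with hγ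
  have hdm := measurable_decodeCost (x := l / σ)
  have hfm : Measurable fun p : ℝ × ℝ =>
      a + b * p.1 - decodeCost (l / σ) ((p.2 - p.1) / σ) := by fun_prop
  have hT : Measurable fun p : ℝ × ℝ => (p.1, p.1 + p.2) := by fun_prop
  have hg : Integrable (fun z => decodeCost (l / σ) (z / σ)) γ := by
    rw [hγ, gaussianReal_eq_map σ, integrable_map_measure
      (Measurable.aestronglyMeasurable (by fun_prop)) (by fun_prop)]
    convert integrable_decodeCost hx using 1
    ext n
    simp [hσ.ne']
  have hgi : ∫ z, decodeCost (l / σ) (z / σ) ∂γ ≤ gaussMixR (σ / l) := by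
    rw [hγ, gaussianReal_eq_map σ, integral_map (by fun_prop)
      (Measurable.aestronglyMeasurable (by fun_prop))]
    have := integral_decodeCost_le hx
    rw [one_div_div] at this
    convert this using 3
    simp [hσ.ne']
  have hi1 : Integrable (fun p : ℝ × ℝ => a + b * p.1) (μ.prod γ) :=
    (integrable_const a).add ((hμ.comp_fst γ).const_mul b)
  have hi2 : Integrable (fun p : ℝ × ℝ => decodeCost (l / σ) (p.2 / σ)) (μ.prod γ) :=
    hg.comp_snd μ
  have hcomp : ((fun p : ℝ × ℝ => a + b * p.1 - decodeCost (l / σ) ((p.2 - p.1) / σ)) ∘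
      fun p : ℝ × ℝ => (p.1, p.1 + p.2)) =
      fun p => (a + b * p.1) - decodeCost (l / σ) (p.2 / σ) := by
    ext p
    simp
  have hP : IsProbabilityMeasure ((μ.prod γ).map fun p : ℝ × ℝ => (p.1, p.1 + p.2)) :=
    Measure.isProbabilityMeasure_map hT.aemeasurable
  have hP1 : IsProbabilityMeasure ((μ.prod γ).map fun p : ℝ × ℝ => p.1) :=
    Measure.isProbabilityMeasure_map (by fun_prop)
  have hP2 : IsProbabilityMeasure ((μ.prod γ).map fun p : ℝ × ℝ => p.1 + p.2) :=
    Measure.isProbabilityMeasure_map (by fun_prop)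
  have hfst : ((μ.prod γ).map fun p : ℝ × ℝ => p.1) = μ := by
    simp
  have key := integral_le_klDiv
    (P := (μ.prod γ).map fun p : ℝ × ℝ => (p.1, p.1 + p.2))
    (Q := ((μ.prod γ).map fun p : ℝ × ℝ => p.1).prod ((μ.prod γ).map fun p : ℝ × ℝ => p.1 + p.2))
    hfm ?_ ?_
  · rw [channelInfo, mutualInfo]
    refine le_trans ?_ key
    rw [integral_map hT.aemeasurable hfm.aestronglyMeasurable]
    have : ∀ p : ℝ × ℝ, a + b * p.1 - decodeCost (l / σ) ((p.1 + p.2 - p.1) / σ) =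
        (a + b * p.1) - decodeCost (l / σ) (p.2 / σ) := fun p => congrFun hcomp p
    simp only [this]
    rw [integral_sub hi1 hi2, integral_add (integrable_const a) ((hμ.comp_fst γ).const_mul b),
      integral_const_mul, integral_fun_fst (fun x => x),
      integral_fun_snd (fun z => decodeCost (l / σ) (z / σ))]
    simp only [integral_const, probReal_univ, smul_eq_mul, one_mul]
    exact_mod_cast by linarith
  · rw [integrable_map_measure hfm.aestronglyMeasurable hT.aemeasurable, hcomp]
    exact hi1.sub hi2
  · rw [hfst, lintegral_prod_symm _ (by fun_prop)]
    calc _ ≤ ∫⁻ _, 1 ∂((μ.prod γ).map fun p : ℝ × ℝ => p.1 + p.2) := lintegral_mono fun y => h y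
      _ = 1 := by simp

/-- By periodicity all terms share the denominator θ(n); over ℤ they would sum to exactly 1. -/
lemma tsum_exp_neg_decodeCost_le {x : ℝ} (hx : 0 < x) (n : ℝ) :
    ∑' j : ℕ, ENNReal.ofReal (Real.exp (-decodeCost x (n - 2 * x * j))) ≤ 1 := by
  have h1 : ∀ j : ℤ, Real.exp (-decodeCost x (n - 2 * x * j)) =
      Real.exp (-(n - 2 * x * j) ^ 2 / 2) / gaussTheta x n := by
    intro j
    rw [decodeCost, gaussTheta_add, neg_add, Real.exp_add, Real.exp_neg (Real.log _),
      Real.exp_log (gaussTheta_pos hx n), neg_div]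
    rfl
  calc ∑' j : ℕ, ENNReal.ofReal (Real.exp (-decodeCost x (n - 2 * x * j)))
      = ∑' j : ℕ, (fun j : ℤ => ENNReal.ofReal
          (Real.exp (-(n - 2 * x * j) ^ 2 / 2) / gaussTheta x n)) j := by
        refine tsum_congr fun j => ?_
        have h2 := h1 j
        simp only [Int.cast_natCast] at h2 ⊢
        rw [h2]
    _ ≤ ∑' j : ℤ, ENNReal.ofReal (Real.exp (-(n - 2 * x * j) ^ 2 / 2) / gaussTheta x n) :=
        ENNReal.tsum_comp_le_tsum_of_injective Nat.cast_injective _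
    _ = 1 := by
        rw [← ENNReal.ofReal_tsum_of_nonneg
          (fun j => div_nonneg (Real.exp_pos _).le (gaussTheta_pos hx n).le)
          ((summable_gaussTheta hx n).div_const _), tsum_div_const]
        change ENNReal.ofReal (gaussTheta x n / gaussTheta x n) = 1
        rw [div_self (gaussTheta_pos hx n).ne', ENNReal.ofReal_one]

/-! ### Lattice inputs. -/

/-- The law giving mass `p j` to the lattice point `2 l j`. -/
noncomputable def latticeLaw (l : ℝ) (p : ℕ → ℝ) : Measure ℝ :=
  Measure.sum fun j : ℕ => ENNReal.ofReal (p j) • Measure.dirac (2 * l * j)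

lemma latticeLaw_isEquispacedLaw {K : ℕ∞} {l : ℝ} {p : ℕ → ℝ} (hl : 0 < l)
    (hp : ∀ j : ℕ, (j : ℕ∞) ≤ K → 0 < p j) (hp0 : ∀ j : ℕ, ¬ (j : ℕ∞) ≤ K → p j = 0)
    (hsum : HasSum p 1) : IsEquispacedLaw K l (latticeLaw l p) := by
  have hnn : ∀ j, 0 ≤ p j := fun j => by
    by_cases hj : (j : ℕ∞) ≤ K
    · exact (hp j hj).le
    · exact (hp0 j hj).ge
  refine ⟨hl, ⟨?_⟩, ?_, ?_⟩
  · rw [latticeLaw, Measure.sum_apply _ MeasurableSet.univ]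
    simp only [Measure.smul_apply, measure_univ, smul_eq_mul, mul_one]
    rw [← ENNReal.ofReal_tsum_of_nonneg hnn hsum.summable, hsum.tsum_eq, ENNReal.ofReal_one]
  · have hc : (equispacedSet K l).Countable := by
      refine (countable_range fun j : ℕ => 2 * l * (j : ℝ)).mono ?_
      rintro x ⟨j, -, rfl⟩
      exact ⟨j, rfl⟩
    rw [latticeLaw, Measure.sum_apply _ hc.measurableSet.compl, ENNReal.tsum_eq_zero]
    intro j
    by_cases hj : (j : ℕ∞) ≤ K
    · have : 2 * l * (j : ℝ) ∉ (equispacedSet K l)ᶜ := fun h => h ⟨j, hj, rfl⟩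
      simp [this]
    · simp [hp0 j hj]
  · rintro x ⟨j, hj, rfl⟩
    refine lt_of_lt_of_le ?_ (Measure.le_sum_apply _ _)
    refine lt_of_lt_of_le ?_ (ENNReal.le_tsum j)
    simpa using hp j hj

lemma lintegral_latticeLaw (l : ℝ) (p : ℕ → ℝ) (f : ℝ → ℝ≥0∞) :
    ∫⁻ x, f x ∂latticeLaw l p = ∑' j : ℕ, ENNReal.ofReal (p j) * f (2 * l * j) := by
  simp [latticeLaw, lintegral_sum_measure]

lemma latticeLaw_mean {l m : ℝ} {p : ℕ → ℝ} (hl : 0 < l) (hnn : ∀ j, 0 ≤ p j)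
    (hm : HasSum (fun j : ℕ => j * p j) m) :
    Integrable (fun x => x) (latticeLaw l p) ∧ ∫ x, x ∂latticeLaw l p = 2 * l * m := by
  have hi : Integrable (fun x : ℝ => x) (latticeLaw l p) := by
    refine integrable_sum_dirac (fun _ => ENNReal.ofReal_ne_top) ?_
    refine (hm.summable.mul_left (2 * l)).congr fun j => ?_
    rw [ENNReal.toReal_ofReal (hnn j), Real.norm_of_nonneg (by positivity)]
    ring
  refine ⟨hi, ?_⟩
  have h := hasSum_integral_measure hi
  refine h.unique ?_
  refine (hm.mul_left (2 * l)).congr_fun fun j => ?_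
  rw [integral_smul_measure, integral_dirac, ENNReal.toReal_ofReal (hnn j), smul_eq_mul]
  ring

lemma IsEquispacedLaw.ae_mem {K : ℕ∞} {l : ℝ} {μ : Measure ℝ} (h : IsEquispacedLaw K l μ) :
    ∀ᵐ x ∂μ, x ∈ equispacedSet K l := h.null_compl

lemma IsEquispacedLaw.nonnegIntensity {K : ℕ∞} {l : ℝ} {μ : Measure ℝ}
    (h : IsEquispacedLaw K l μ) : NonnegIntensity μ := by
  refine h.ae_mem.mono ?_
  rintro x ⟨j, -, rfl⟩
  have := h.spacing_pos
  positivity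

lemma IsEquispacedLaw.peakConstraint {K : ℕ} {l : ℝ} {μ : Measure ℝ}
    (h : IsEquispacedLaw K l μ) (hK : 2 * l * K ≤ 1) : PeakConstraint μ := by
  refine h.ae_mem.mono ?_
  rintro x ⟨j, hj, rfl⟩
  have h1 := h.spacing_pos
  have h2 : (j : ℝ) ≤ K := by exact_mod_cast hj
  refine le_trans ?_ hK
  gcongr

/-- A lattice input whose masses are `exp (-(a + b j))` on its support has entropy `a + b m`, `m`
being the mean index, and its equivocation is at most `gaussMixR (σ / l)`. -/
lemma le_channelInfo_latticeLaw {σ l m a b : ℝ} {K : ℕ∞} {p : ℕ → ℝ} (hσ : 0 < σ) (hl : 0 < l)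
    (hp : ∀ j : ℕ, (j : ℕ∞) ≤ K → p j = Real.exp (-(a + b * j)))
    (hp0 : ∀ j : ℕ, ¬ (j : ℕ∞) ≤ K → p j = 0)
    (hsum : HasSum p 1) (hm : HasSum (fun j : ℕ => j * p j) m) :
    ((a + b * m - gaussMixR (σ / l) : ℝ) : EReal) ≤ (channelInfo σ (latticeLaw l p) : EReal) := by
  have hpos : ∀ j : ℕ, (j : ℕ∞) ≤ K → 0 < p j := fun j hj => by rw [hp j hj]; positivity
  have hnn : ∀ j, 0 ≤ p j := fun j => by
    by_cases hj : (j : ℕ∞) ≤ K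
    · exact (hpos j hj).le
    · exact (hp0 j hj).ge
  have hlaw := latticeLaw_isEquispacedLaw hl hpos hp0 hsum
  have := hlaw.isProbabilityMeasure
  obtain ⟨hi, hmean⟩ := latticeLaw_mean hl hnn hm
  -- The slope is divided by 2l because the test function is affine in x = 2lj, not in j. On the
  -- support, exp(a + bj) then cancels the mass `p j`.
  have key := le_channelInfo hσ hl (latticeLaw l p) hi a (b / (2 * l)) ?_
  · rw [hmean] at key
    convert key using 4
    field_simp
  · intro y
    rw [lintegral_latticeLaw]
    refine le_trans (ENNReal.tsum_le_tsum fun j => ?_)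
      (tsum_exp_neg_decodeCost_le (by positivity : 0 < l / σ) (y / σ))
    rw [← ENNReal.ofReal_mul (hnn j)]
    refine ENNReal.ofReal_le_ofReal ?_
    by_cases hj : (j : ℕ∞) ≤ K
    · rw [hp j hj, ← Real.exp_add]
      apply le_of_eq
      have h1 : (y - 2 * l * j) / σ = y / σ - 2 * (l / σ) * j := by field_simp
      have h2 : b / (2 * l) * (2 * l * j) = b * j := by field_simp
      rw [h1, h2]
      congr 1
      ring
    · rw [hp0 j hj, zero_mul]
      positivity

/-! ### Regularity of R and attainment of suprema. -/

lemma continuous_gaussianQ : Continuous gaussianQ := by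
  have hi := integrable_gaussianPDFReal 0 1
  have h : gaussianQ = fun x => (∫ n in Iic (0 : ℝ), gaussianPDFReal 0 1 n) +
      ∫ n in (0 : ℝ)..(-x), gaussianPDFReal 0 1 n := by
    ext x
    rw [← gaussianReal_Iic_neg, measureReal_def, gaussianReal_apply_eq_integral _ one_ne_zero,
      ENNReal.toReal_ofReal (integral_nonneg fun n => gaussianPDFReal_nonneg 0 1 n),
      ← intervalIntegral.integral_Iic_sub_Iic hi.integrableOn hi.integrableOn]
    ring
  rw [h]
  exact continuous_const.add ((intervalIntegral.continuous_primitive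
    (fun _ _ => hi.intervalIntegrable) 0).comp continuous_neg)

lemma gaussianQ_zero : gaussianQ 0 = 1 / 2 := by
  have h1 := gaussianReal_Iic_neg 0
  have h2 := probReal_compl_eq_one_sub (μ := gaussianReal 0 1) (measurableSet_Iic (a := (0 : ℝ)))
  rw [compl_Iic] at h2
  rw [neg_zero] at h1
  change gaussianQ 0 = _ at h2
  linarith

lemma gaussMixR_nonneg {u : ℝ} (hu : 0 < u) : 0 ≤ gaussMixR u := by
  have h1 := gaussianQ_nonneg (1 / u)
  have h2 : 0 ≤ Real.log (5 + 2 * u ^ 2) := Real.log_nonneg (by nlinarith)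
  have h3 : 0 ≤ Real.log (1 + Real.sqrt (9 * Real.pi / 2) * u) :=
    Real.log_nonneg (by linarith [mul_nonneg (Real.sqrt_nonneg (9 * Real.pi / 2)) hu.le])
  unfold gaussMixR
  positivity

lemma continuousOn_gaussMixR : ContinuousOn gaussMixR (Ioi 0) := by
  have h1 : ContinuousOn (fun u : ℝ => gaussianQ (1 / u)) (Ioi 0) :=
    continuous_gaussianQ.comp_continuousOn
      (continuousOn_const.div continuousOn_id fun u hu => (ne_of_gt hu))
  have h2 : ContinuousOn (fun u : ℝ => 1 / (2 * u ^ 2)) (Ioi 0) :=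
    continuousOn_const.div (by fun_prop) fun u hu => by
      have : (0 : ℝ) < u := hu
      positivity
  have h3 : ContinuousOn (fun u : ℝ => Real.log (5 + 2 * u ^ 2)) (Ioi 0) :=
    ContinuousOn.log (by fun_prop) fun u _ => by positivity
  have h4 : ContinuousOn (fun u : ℝ => Real.log (1 + Real.sqrt (9 * Real.pi / 2) * u)) (Ioi 0) :=
    ContinuousOn.log (by fun_prop) fun u hu => by
      have : (0 : ℝ) < u := hu
      positivity
  unfold gaussMixR
  exact (continuousOn_const.mul h1).mul (((continuousOn_const.add h2).add h3).add h4)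

lemma exists_le_of_isCompact {G : ℝ → ℝ} {s C : Set ℝ} {x₀ : ℝ} (hC : IsCompact C) (hCs : C ⊆ s)
    (hG : ContinuousOn G C) (hx₀ : x₀ ∈ C) (hout : ∀ x ∈ s, x ∉ C → G x ≤ G x₀) :
    ∃ x ∈ s, ∀ y ∈ s, G y ≤ G x := by
  obtain ⟨x, hx, hmax⟩ := hC.exists_isMaxOn ⟨x₀, hx₀⟩ hG
  refine ⟨x, hCs hx, fun y hy => ?_⟩
  by_cases hyC : y ∈ C
  · exact hmax hyC
  · exact (hout y hy hyC).trans (hmax hx₀)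

/-! ### Truncated geometric laws, written as finite sums so that q = 1 (that is, t = 0) is not
singular. -/

/-- The normalising constant of the truncated geometric law with ratio `q`. -/
noncomputable def geomNorm (K : ℕ) (q : ℝ) : ℝ := ∑ j ∈ Finset.range (K + 1), q ^ j

/-- The mean of the truncated geometric law with ratio `q`. -/
noncomputable def geomMean (K : ℕ) (q : ℝ) : ℝ :=
  (∑ j ∈ Finset.range (K + 1), (j : ℝ) * q ^ j) / geomNorm K q

/-- The entropy of the truncated geometric law with ratio `q`. -/
noncomputable def geomEntropy (K : ℕ) (q : ℝ) : ℝ :=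
  Real.log (geomNorm K q) - geomMean K q * Real.log q

lemma one_le_geomNorm (K : ℕ) {q : ℝ} (hq : 0 ≤ q) : 1 ≤ geomNorm K q := by
  have := Finset.single_le_sum (f := fun j => q ^ j) (fun j _ => pow_nonneg hq j)
    (Finset.mem_range.2 (Nat.succ_pos K))
  simpa [geomNorm] using this

lemma geomNorm_pos (K : ℕ) {q : ℝ} (hq : 0 ≤ q) : 0 < geomNorm K q :=
  zero_lt_one.trans_le (one_le_geomNorm K hq)

lemma geomMean_pos {K : ℕ} (hK : 1 ≤ K) {q : ℝ} (hq : 0 < q) : 0 < geomMean K q := by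
  refine div_pos (Finset.sum_pos' (fun j _ => by positivity) ⟨1, ?_, ?_⟩) (geomNorm_pos K hq.le)
  · simp; omega
  · simpa using hq

lemma continuousOn_geomMean (K : ℕ) : ContinuousOn (geomMean K) (Ici 0) := by
  unfold geomMean
  refine ContinuousOn.div (by fun_prop) ?_ fun q hq => (geomNorm_pos K hq).ne'
  unfold geomNorm
  fun_prop

/-- Isolates q log q, which is continuous at 0, so that the entropy is continuous up to q = 0. The
truncated exponent j − 1 at j = 0 is harmless because of the factor j. -/
lemma geomMean_mul_log (K : ℕ) (q : ℝ) : geomMean K q * Real.log q =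
    q * Real.log q * ((∑ j ∈ Finset.range (K + 1), (j : ℝ) * q ^ (j - 1)) / geomNorm K q) := by
  have h : ∑ j ∈ Finset.range (K + 1), (j : ℝ) * q ^ j =
      q * ∑ j ∈ Finset.range (K + 1), (j : ℝ) * q ^ (j - 1) := by
    rw [Finset.mul_sum]
    refine Finset.sum_congr rfl fun j _ => ?_
    rcases j with _ | j
    · simp
    · rw [Nat.add_sub_cancel, pow_succ]
      ring
  rw [geomMean, h]
  ring

lemma continuousOn_geomEntropy (K : ℕ) : ContinuousOn (geomEntropy K) (Ici 0) := by
  have hS : ContinuousOn (geomNorm K) (Ici 0) := by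
    unfold geomNorm
    fun_prop
  have h0 : ∀ q ∈ Ici (0 : ℝ), geomNorm K q ≠ 0 := fun q hq => (geomNorm_pos K hq).ne'
  unfold geomEntropy
  simp_rw [geomMean_mul_log]
  exact (hS.log h0).sub (Real.continuous_mul_log.continuousOn.mul
    (ContinuousOn.div (by fun_prop) hS h0))

lemma geomEntropy_zero (K : ℕ) : geomEntropy K 0 = 0 := by
  simp [geomEntropy, geomNorm, Finset.sum_range_succ']

lemma geomNorm_one (K : ℕ) : geomNorm K 1 = K + 1 := by simp [geomNorm]

lemma sum_range_cast (K : ℕ) : ∑ j ∈ Finset.range (K + 1), (j : ℝ) = K * (K + 1) / 2 := by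
  induction K with
  | zero => simp
  | succ K ih => rw [Finset.sum_range_succ, ih]; push_cast; ring

lemma geomMean_one (K : ℕ) : geomMean K 1 = K / 2 := by
  have h : (K : ℝ) + 1 ≠ 0 := by positivity
  simp only [geomMean, geomNorm_one, one_pow, mul_one, sum_range_cast]
  field_simp

lemma geomEntropy_one (K : ℕ) : geomEntropy K 1 = Real.log (K + 1) := by
  simp [geomEntropy, geomNorm_one]

lemma geomMean_zero (K : ℕ) : geomMean K 0 = 0 := by
  simp [geomMean, Finset.sum_range_succ']

lemma one_sub_mul_geomNorm (K : ℕ) (q : ℝ) : (1 - q) * geomNorm K q = 1 - q ^ (K + 1) := by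
  have := geom_sum_mul q (K + 1)
  simp only [geomNorm]
  linarith

lemma one_sub_mul_sum (K : ℕ) (q : ℝ) :
    (1 - q) * ∑ j ∈ Finset.range (K + 1), (j : ℝ) * q ^ j =
      (K * (1 - q) + 1) * geomNorm K q - (K + 1) := by
  induction K with
  | zero => simp [geomNorm]
  | succ K ih =>
    have h := one_sub_mul_geomNorm K q
    have h2 : geomNorm (K + 1) q = geomNorm K q + q ^ (K + 1) := by
      simp only [geomNorm]
      rw [Finset.sum_range_succ]
    rw [Finset.sum_range_succ, mul_add, ih, h2]
    push_cast
    linear_combination -h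

lemma geomNorm_eq (K : ℕ) {t : ℝ} (ht : t ∈ Ioo (0 : ℝ) 1) :
    geomNorm K (1 - t) = (1 - (1 - t) ^ (K + 1)) / t := by
  have := one_sub_mul_geomNorm K (1 - t)
  rw [eq_div_iff ht.1.ne']
  linarith

lemma geomMean_eq (K : ℕ) {t : ℝ} (ht : t ∈ Ioo (0 : ℝ) 1) :
    geomMean K (1 - t) = truncGeomMean K t := by
  have hS := geomNorm_pos K (sub_nonneg.2 ht.2.le)
  have ht0 := ht.1.ne'
  have h1 := one_sub_mul_sum K (1 - t)
  rw [truncGeomMean, ← one_sub_mul_geomNorm, geomMean]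
  rw [sub_sub_cancel] at h1 ⊢
  field_simp
  linarith

lemma truncGeomBound_eq (K : ℕ) (α σ : ℝ) {t : ℝ} (ht : t ∈ Ioo (0 : ℝ) 1) :
    truncGeomBound K α σ t =
      geomEntropy K (1 - t) - gaussMixR (2 * geomMean K (1 - t) * (σ / α)) := by
  rw [truncGeomBound, geomEntropy, geomNorm_eq K ht, geomMean_eq K ht]

/-- With c the mean at q and r = q'/q > 1, (j − c)r^j ≥ (j − c)r^c for either sign of j − c.
Weighting by q^j and summing gives Σ(j − c)q'^j > r^c·Σ(j − c)q^j = 0, strict because of j = 0. -/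
lemma strictMonoOn_geomMean {K : ℕ} (hK : 1 ≤ K) : StrictMonoOn (geomMean K) (Ioi 0) := by
  intro q hq q' hq' hlt
  have hq0 : (0 : ℝ) < q := hq
  have hq0' : (0 : ℝ) < q' := hq'
  set c := geomMean K q with hc
  have hcpos : 0 < c := geomMean_pos hK hq0
  have hr : 1 < q' / q := (one_lt_div hq0).2 hlt
  set r := q' / q
  have hqr : q' = q * r := by simp only [r]; field_simp
  have h0 : ∑ j ∈ Finset.range (K + 1), ((j : ℝ) - c) * q ^ j = 0 := by
    simp_rw [sub_mul]
    rw [Finset.sum_sub_distrib, ← Finset.mul_sum]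
    change _ - c * geomNorm K q = 0
    rw [hc, geomMean, div_mul_cancel₀ _ (geomNorm_pos K hq0.le).ne', sub_self]
  have hterm : ∀ j : ℕ, r ^ c * (((j : ℝ) - c) * q ^ j) ≤ ((j : ℝ) - c) * q' ^ j := by
    intro j
    have h1 : ((j : ℝ) - c) * r ^ c ≤ ((j : ℝ) - c) * r ^ j := by
      rw [← Real.rpow_natCast]
      rcases le_total c j with h | h
      · exact mul_le_mul_of_nonneg_left (Real.rpow_le_rpow_of_exponent_le hr.le h)
          (sub_nonneg.2 h)
      · exact mul_le_mul_of_nonpos_left (Real.rpow_le_rpow_of_exponent_le hr.le h)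
          (sub_nonpos.2 h)
    have h2 := mul_le_mul_of_nonneg_right h1 (pow_nonneg hq0.le j)
    rw [hqr, mul_pow]
    linarith
  have hstrict : ∑ j ∈ Finset.range (K + 1), r ^ c * (((j : ℝ) - c) * q ^ j) <
      ∑ j ∈ Finset.range (K + 1), ((j : ℝ) - c) * q' ^ j := by
    refine Finset.sum_lt_sum (fun j _ => hterm j) ⟨0, by simp, ?_⟩
    have := Real.one_lt_rpow hr hcpos
    simp
    nlinarith
  rw [← Finset.mul_sum, h0, mul_zero] at hstrict
  simp_rw [sub_mul] at hstrict
  rw [Finset.sum_sub_distrib, ← Finset.mul_sum, sub_pos] at hstrict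
  exact (lt_div_iff₀ (geomNorm_pos K hq0'.le)).2 hstrict

/-! ### Geometric inputs and their rates. -/

lemma exists_truncGeom_input {σ l q : ℝ} (hσ : 0 < σ) (hl : 0 < l) (hq : 0 < q) (K : ℕ) :
    ∃ μ : Measure ℝ, IsEquispacedLaw K l μ ∧ Integrable (fun x : ℝ => x) μ ∧
      ∫ x, x ∂μ = 2 * l * geomMean K q ∧
      ((geomEntropy K q - gaussMixR (σ / l) : ℝ) : EReal) ≤ (channelInfo σ μ : EReal) := by
  have hS := geomNorm_pos K hq.le
  set p : ℕ → ℝ := fun j => if j ≤ K then q ^ j / geomNorm K q else 0 with hp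
  have hp1 : ∀ j : ℕ, (j : ℕ∞) ≤ K → p j = q ^ j / geomNorm K q := fun j hj => by
    have : j ≤ K := by exact_mod_cast hj
    simp [hp, this]
  have hp0 : ∀ j : ℕ, ¬ (j : ℕ∞) ≤ K → p j = 0 := fun j hj => by
    have : ¬ j ≤ K := by exact_mod_cast hj
    simp [hp, this]
  have hpos : ∀ j : ℕ, (j : ℕ∞) ≤ K → 0 < p j := fun j hj => by
    rw [hp1 j hj]
    positivity
  have hnn : ∀ j, 0 ≤ p j := fun j => by
    by_cases hj : (j : ℕ∞) ≤ K
    · exact (hpos j hj).le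
    · exact (hp0 j hj).ge
  have hsumf : ∀ f : ℕ → ℝ, HasSum (fun j => f j * p j)
      ((∑ j ∈ Finset.range (K + 1), f j * q ^ j) / geomNorm K q) := by
    intro f
    have h : HasSum (fun j => f j * p j) (∑ j ∈ Finset.range (K + 1), f j * p j) :=
      hasSum_sum_of_ne_finset_zero (fun j hj => by
        have : ¬ j ≤ K := by simpa [Nat.lt_succ_iff] using hj
        simp [hp, this])
    rw [Finset.sum_div]
    convert h using 1
    refine Finset.sum_congr rfl fun j hj => ?_
    have : j ≤ K := by simpa [Nat.lt_succ_iff] using hj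
    simp [hp, this, mul_div_assoc]
  have hsum : HasSum p 1 := by
    have h := hsumf fun _ => 1
    simp only [one_mul] at h
    change HasSum p (geomNorm K q / geomNorm K q) at h
    rwa [div_self hS.ne'] at h
  have hm : HasSum (fun j : ℕ => (j : ℝ) * p j) (geomMean K q) := hsumf fun j => j
  obtain ⟨hi, hmean⟩ := latticeLaw_mean hl hnn hm
  refine ⟨latticeLaw l p, latticeLaw_isEquispacedLaw hl hpos hp0 hsum, hi, hmean, ?_⟩
  have key := le_channelInfo_latticeLaw (a := Real.log (geomNorm K q)) (b := -Real.log q) hσ hl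
    (fun j hj => by
      rw [hp1 j hj, neg_add, Real.exp_add, Real.exp_neg, Real.exp_log hS, neg_mul, neg_neg,
        mul_comm (Real.log q), Real.exp_nat_mul, Real.exp_log hq]
      field_simp) hp0 hsum hm
  convert key using 4
  rw [geomEntropy]
  ring

lemma exists_geom_input {σ l s : ℝ} (hσ : 0 < σ) (hl : 0 < l) (hs : 0 < s) :
    ∃ μ : Measure ℝ, IsEquispacedLaw ⊤ l μ ∧ Integrable (fun x : ℝ => x) μ ∧
      ∫ x, x ∂μ = 2 * l * s ∧
      ((Real.log (1 + s) + s * Real.log (1 + 1 / s) - gaussMixR (σ / l) : ℝ) : EReal) ≤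
        (channelInfo σ μ : EReal) := by
  -- The ratio for which the geometric law on ℕ has mean s.
  set q := s / (1 + s) with hq
  have hq0 : 0 < q := by positivity
  have hq1 : q < 1 := by rw [hq, div_lt_one (by positivity)]; linarith
  have h1q : 1 - q = (1 + s)⁻¹ := by rw [hq]; field_simp; ring
  set p : ℕ → ℝ := fun j => (1 - q) * q ^ j with hp
  have hpos : ∀ j : ℕ, 0 < p j := fun j => mul_pos (by linarith) (by positivity)
  have hsum : HasSum p 1 := by
    have h := (hasSum_geometric_of_lt_one hq0.le hq1).mul_left (1 - q)
    rwa [mul_inv_cancel₀ (by linarith)] at h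
  have hm : HasSum (fun j : ℕ => (j : ℝ) * p j) s := by
    have h := (hasSum_coe_mul_geometric_of_norm_lt_one (r := q)
      (by rwa [Real.norm_of_nonneg hq0.le])).mul_left (1 - q)
    have h2 : (1 - q) * (q / (1 - q) ^ 2) = s := by
      rw [h1q, hq]
      field_simp
    rw [h2] at h
    refine h.congr_fun fun j => ?_
    simp only [hp]
    ring
  obtain ⟨hi, hmean⟩ := latticeLaw_mean hl (fun j => (hpos j).le) hm
  refine ⟨latticeLaw l p, latticeLaw_isEquispacedLaw hl (fun j _ => hpos j)
    (fun j hj => absurd le_top hj) hsum, hi, hmean, ?_⟩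
  have key := le_channelInfo_latticeLaw (K := ⊤) (a := Real.log (1 + s))
    (b := Real.log (1 + 1 / s)) hσ hl
    (fun j _ => by
      rw [neg_add, Real.exp_add, Real.exp_neg, Real.exp_log (by positivity),
        mul_comm (Real.log (1 + 1 / s)), ← mul_neg, Real.exp_nat_mul, Real.exp_neg,
        Real.exp_log (by positivity)]
      change (1 - q) * q ^ j = _
      rw [h1q]
      congr 2
      rw [hq]
      field_simp
      ring) (fun j hj => absurd le_top hj) hsum hm
  rwa [mul_comm s]

/-- The lower bound on the information carried by the truncated geometric input of ratio `q` and
mean `α`. -/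
noncomputable def truncGeomRate (K : ℕ) (α σ q : ℝ) : ℝ :=
  geomEntropy K q - gaussMixR (2 * geomMean K q * (σ / α))

lemma continuousOn_truncGeomRate {K : ℕ} {α σ : ℝ} (hK : 1 ≤ K) (hα : 0 < α) (hσ : 0 < σ) :
    ContinuousOn (truncGeomRate K α σ) (Ioi 0) := by
  refine ((continuousOn_geomEntropy K).mono Ioi_subset_Ici_self).sub ?_
  refine continuousOn_gaussMixR.comp ?_ fun q hq => ?_
  · exact (continuousOn_const.mul ((continuousOn_geomMean K).mono Ioi_subset_Ici_self)).mul
      continuousOn_const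
  · have := geomMean_pos hK hq
    show 0 < 2 * geomMean K q * (σ / α)
    positivity

lemma exists_truncGeomRate_input {K : ℕ} {α σ q : ℝ} (hK : 1 ≤ K) (hα : 0 < α) (hσ : 0 < σ)
    (hq : 0 < q) :
    ∃ μ : Measure ℝ, IsEquispacedLaw K (α / (2 * geomMean K q)) μ ∧ AverageConstraint α μ ∧
      ((truncGeomRate K α σ q : ℝ) : EReal) ≤ (channelInfo σ μ : EReal) := by
  have hm := geomMean_pos hK hq
  obtain ⟨μ, h1, h2, h3, h4⟩ :=
    exists_truncGeom_input (l := α / (2 * geomMean K q)) hσ (by positivity) hq K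
  refine ⟨μ, h1, ⟨h2, ?_⟩, ?_⟩
  · rw [h3]
    apply le_of_eq
    field_simp
  · convert h4 using 4
    rw [truncGeomRate]
    congr 2
    field_simp

/-- The rate is at most the entropy, which tends to 0 with q; one positive value therefore confines
the search to a compact [δ, 1]. -/
lemma exists_truncGeomRate_max {K : ℕ} {α σ : ℝ} (hK : 1 ≤ K) (hα : 0 < α) (hσ : 0 < σ)
    (h : ∃ q ∈ Ioc (0 : ℝ) 1, 0 < truncGeomRate K α σ q) :
    ∃ q ∈ Ioc (0 : ℝ) 1, ∀ q' ∈ Ioc (0 : ℝ) 1, truncGeomRate K α σ q' ≤ truncGeomRate K α σ q := by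
  obtain ⟨q₀, hq₀, hpos⟩ := h
  have hlim : ∀ᶠ q in nhdsWithin 0 (Ici (0 : ℝ)), geomEntropy K q < truncGeomRate K α σ q₀ := by
    have := continuousOn_geomEntropy K 0 self_mem_Ici
    rw [ContinuousWithinAt, geomEntropy_zero] at this
    exact this.eventually_lt_const hpos
  obtain ⟨δ, hδ, hsub⟩ := mem_nhdsGE_iff_exists_Ico_subset.1 hlim
  have hδ0 : (0 : ℝ) < δ := hδ
  have hlow : ∀ q, 0 < q → q < δ → truncGeomRate K α σ q < truncGeomRate K α σ q₀ := by
    intro q hq hqδ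
    have h1 : geomEntropy K q < truncGeomRate K α σ q₀ := hsub ⟨hq.le, hqδ⟩
    have hm := geomMean_pos hK hq
    have h2 := gaussMixR_nonneg (u := 2 * geomMean K q * (σ / α)) (by positivity)
    rw [truncGeomRate]
    linarith
  refine exists_le_of_isCompact (C := Icc δ 1) (x₀ := q₀) isCompact_Icc
    (fun q hq => ⟨hδ0.trans_le hq.1, hq.2⟩)
    ((continuousOn_truncGeomRate hK hα hσ).mono fun q hq => hδ0.trans_le hq.1) ⟨?_, hq₀.2⟩ ?_
  · by_contra! hlt
    exact lt_irrefl _ (hlow q₀ hq₀.1 hlt)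
  · intro q hq hqC
    refine (hlow q hq.1 ?_).le
    by_contra! hle
    exact hqC ⟨hle, hq.2⟩

/-! ### The three claims for finite K. -/

lemma exists_peak_input {σ : ℝ} (hσ : 0 < σ) {K : ℕ} (hK : 1 ≤ K) :
    ∃ (l : ℝ) (μ : Measure ℝ), IsEquispacedLaw K l μ ∧ NonnegIntensity μ ∧ PeakConstraint μ ∧
      ((Real.log (K + 1) - gaussMixR (2 * K * σ) : ℝ) : EReal) ≤ (channelInfo σ μ : EReal) := by
  have hK0 : (0 : ℝ) < K := by exact_mod_cast hK
  obtain ⟨μ, h1, -, -, h4⟩ :=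
    -- Ratio 1 is the uniform law; this spacing puts the top point at 1.
    exists_truncGeom_input (l := 1 / (2 * (K : ℝ))) hσ (by positivity) one_pos K
  refine ⟨_, μ, h1, h1.nonnegIntensity, h1.peakConstraint (le_of_eq (by field_simp)), ?_⟩
  rw [geomEntropy_one] at h4
  convert h4 using 5
  field_simp

lemma exists_average_input {σ α : ℝ} (hσ : 0 < σ) (hα : 0 < α) {K : ℕ} (hK : 1 ≤ K) :
    ∃ (l : ℝ) (μ : Measure ℝ), IsEquispacedLaw K l μ ∧ NonnegIntensity μ ∧
      AverageConstraint α μ ∧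
      (⨆ t ∈ Ioo (0 : ℝ) 1, ((truncGeomBound K α σ t : ℝ) : EReal))
        ≤ (channelInfo σ μ : EReal) := by
  have hmem : ∀ t ∈ Ioo (0 : ℝ) 1, 1 - t ∈ Ioc (0 : ℝ) 1 := fun t ht =>
    ⟨by linarith [ht.2], by linarith [ht.1]⟩
  by_cases h : ∃ q ∈ Ioc (0 : ℝ) 1, 0 < truncGeomRate K α σ q
  · obtain ⟨q, hq, hmax⟩ := exists_truncGeomRate_max hK hα hσ h
    obtain ⟨μ, h1, h2, h3⟩ := exists_truncGeomRate_input hK hα hσ hq.1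
    refine ⟨_, μ, h1, h1.nonnegIntensity, h2, iSup₂_le fun t ht => le_trans ?_ h3⟩
    rw [truncGeomBound_eq K α σ ht]
    exact_mod_cast hmax _ (hmem t ht)
  · push Not at h
    obtain ⟨μ, h1, h2, -⟩ := exists_truncGeomRate_input hK hα hσ one_pos
    refine ⟨_, μ, h1, h1.nonnegIntensity, h2, iSup₂_le fun t ht => le_trans ?_
      (EReal.coe_ennreal_nonneg _)⟩
    rw [truncGeomBound_eq K α σ ht]
    exact_mod_cast h _ (hmem t ht)

lemma etaEquation_iff (K : ℕ) (α : ℝ) {t : ℝ} (ht : t ∈ Ioo (0 : ℝ) 1) :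
    EtaEquation K α t ↔ geomMean K (1 - t) = α * K := by
  rw [geomMean_eq K ht, EtaEquation, truncGeomMean]
  constructor <;> intro h <;> linarith

lemma exists_geomMean_eq {K : ℕ} {c : ℝ} (hc : 0 < c) (hcK : c < K / 2) :
    ∃ q ∈ Ioo (0 : ℝ) 1, geomMean K q = c := by
  have h := intermediate_value_Ioo zero_le_one
    ((continuousOn_geomMean K).mono (Icc_subset_Ici_self : Icc (0 : ℝ) 1 ⊆ Ici 0))
  rw [geomMean_zero, geomMean_one] at h
  exact h ⟨hc, hcK⟩

lemma exists_peak_average_input {σ α : ℝ} (hσ : 0 < σ) (hα : 0 < α) (hα2 : α < 1 / 2) {K : ℕ}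
    (hK : 1 ≤ K) :
    ∃ η : ℝ, (η ∈ Ioo (0 : ℝ) 1 ∧ EtaEquation K α η) ∧
      (∀ η' : ℝ, η' ∈ Ioo (0 : ℝ) 1 → EtaEquation K α η' → η' = η) ∧
      ∃ (l : ℝ) (μ : Measure ℝ), IsEquispacedLaw K l μ ∧ NonnegIntensity μ ∧
        PeakConstraint μ ∧ AverageConstraint α μ ∧
        (⨆ t ∈ Ioo (0 : ℝ) η, ((truncGeomBound K α σ t : ℝ) : EReal))
          ≤ (channelInfo σ μ : EReal) := by
  have hK0 : (0 : ℝ) < K := by exact_mod_cast hK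
  have hmono := strictMonoOn_geomMean hK
  obtain ⟨q₀, hq₀, hmq₀⟩ := exists_geomMean_eq (K := K) (c := α * K) (by positivity)
    (by nlinarith)
  have hη : 1 - q₀ ∈ Ioo (0 : ℝ) 1 := ⟨by linarith [hq₀.2], by linarith [hq₀.1]⟩
  refine ⟨1 - q₀, ⟨hη, ?_⟩, fun η' hη' h => ?_, ?_⟩
  · rwa [etaEquation_iff K α hη, sub_sub_cancel]
  · rw [etaEquation_iff K α hη', ← hmq₀] at h
    have := hmono.injOn (show (1 - η' : ℝ) ∈ Ioi 0 from sub_pos.2 hη'.2)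
      (show q₀ ∈ Ioi 0 from hq₀.1) h
    linarith
  · obtain ⟨q, hq, hmax⟩ := (isCompact_Icc (a := q₀) (b := 1)).exists_isMaxOn
      ⟨q₀, left_mem_Icc.2 hq₀.2.le⟩
      ((continuousOn_truncGeomRate hK hα hσ).mono fun q hq => hq₀.1.trans_le hq.1)
    have hq0 : 0 < q := hq₀.1.trans_le hq.1
    have hm := geomMean_pos hK hq0
    obtain ⟨μ, h1, h2, h3⟩ := exists_truncGeomRate_input hK hα hσ hq0
    refine ⟨_, μ, h1, h1.nonnegIntensity, h1.peakConstraint ?_, h2,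
      iSup₂_le fun t ht => le_trans ?_ h3⟩
    · have h4 : α * K ≤ geomMean K q := by
        rw [← hmq₀]
        exact hmono.monotoneOn hq₀.1 hq0 hq.1
      have h5 : 2 * (α / (2 * geomMean K q)) * K = α * K / geomMean K q := by field_simp
      rw [h5]
      exact (div_le_one hm).2 h4
    · rw [truncGeomBound_eq K α σ ⟨ht.1, ht.2.trans hη.2⟩]
      have := hmax (show 1 - t ∈ Icc q₀ 1 from ⟨by linarith [ht.2], by linarith [ht.1]⟩)
      exact_mod_cast this

/-! ### The claim for K = ∞. -/

lemma continuousOn_geomBound {α σ : ℝ} (hα : 0 < α) (hσ : 0 < σ) :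
    ContinuousOn (geomBound α σ) (Ioi 0) := by
  have h0 : ContinuousOn (fun l : ℝ => α / (2 * l)) (Ioi 0) :=
    continuousOn_const.div (by fun_prop) fun l hl => by
      have : (0 : ℝ) < l := hl
      positivity
  have h1 : ContinuousOn (fun l : ℝ => Real.log (1 + α / (2 * l))) (Ioi 0) :=
    (continuousOn_const.add h0).log fun l hl => by
      have : (0 : ℝ) < l := hl
      show (1 : ℝ) + α / (2 * l) ≠ 0
      positivity
  have h2 : ContinuousOn (fun l : ℝ => Real.log (1 + 2 * l / α)) (Ioi 0) :=
    ContinuousOn.log (by fun_prop) fun l hl => by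
      have : (0 : ℝ) < l := hl
      positivity
  have h3 : ContinuousOn (fun l : ℝ => gaussMixR (σ / l)) (Ioi 0) :=
    continuousOn_gaussMixR.comp (continuousOn_const.div continuousOn_id fun l hl => ne_of_gt hl)
      fun l hl => div_pos hσ hl
  exact (h1.add (h0.mul h2)).sub h3

lemma mul_log_one_add_inv_le {s : ℝ} (hs : 0 < s) : s * Real.log (1 + 1 / s) ≤ 1 := by
  have h := Real.log_le_sub_one_of_pos (show 0 < 1 + 1 / s by positivity)
  calc s * Real.log (1 + 1 / s) ≤ s * (1 / s) := by gcongr; linarith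
    _ = 1 := by field_simp

lemma geomBound_le {α σ l : ℝ} (hσ : 0 < σ) (hl : 0 < l) :
    geomBound α σ l ≤
      Real.log (1 + α / (2 * l)) + α / (2 * l) * Real.log (1 + 1 / (α / (2 * l))) := by
  have := gaussMixR_nonneg (div_pos hσ hl)
  rw [geomBound, one_div_div]
  linarith

/-- For wide spacing the mean index s = α/(2l) tends to 0, and so does the geometric entropy, which
is continuous at s = 0 once written with s log s. -/
lemma exists_geomBound_lt {α σ c : ℝ} (hα : 0 < α) (hσ : 0 < σ) (hc : 0 < c) :
    ∃ M : ℝ, ∀ l, 0 < l → M < l → geomBound α σ l < c := by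
  have hcont : ContinuousWithinAt (fun s : ℝ => Real.log (1 + s) + (s * Real.log (1 + s) -
      s * Real.log s)) (Ici 0) 0 := by
    have h1 : ContinuousWithinAt (fun s : ℝ => Real.log (1 + s)) (Ici 0) 0 :=
      ContinuousAt.continuousWithinAt (ContinuousAt.log (by fun_prop) (by norm_num))
    exact h1.add ((continuousWithinAt_id.mul h1).sub
      Real.continuous_mul_log.continuousAt.continuousWithinAt)
  have hev := hcont.eventually_lt_const (show _ < c by simpa using hc)
  obtain ⟨δ, hδ, hsub⟩ := mem_nhdsGE_iff_exists_Ico_subset.1 hev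
  have hδ0 : (0 : ℝ) < δ := hδ
  refine ⟨α / (2 * δ), fun l hl hM => (geomBound_le hσ hl).trans_lt ?_⟩
  set s := α / (2 * l) with hs
  have hs0 : 0 < s := by positivity
  have hsδ : s < δ := by
    rw [div_lt_iff₀ (by positivity)] at hM
    rw [hs, div_lt_iff₀ (by positivity)]
    linarith
  have h2 : Real.log (1 + s) + (s * Real.log (1 + s) - s * Real.log s) < c := hsub ⟨hs0.le, hsδ⟩
  have h3 : 1 + 1 / s = (1 + s) / s := by field_simp; ring
  rw [h3, Real.log_div (by positivity) hs0.ne']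
  linarith

lemma le_gaussMixR {u : ℝ} (hu : 1 ≤ u) (hQ : 1 / 3 < gaussianQ (1 / u)) :
    4 / 3 + 2 * Real.log u ≤ gaussMixR u := by
  have hu0 : 0 < u := by linarith
  have hs : 1 ≤ Real.sqrt (9 * Real.pi / 2) :=
    Real.one_le_sqrt.2 (by nlinarith [Real.pi_gt_three])
  have hlog : 0 ≤ Real.log u := Real.log_nonneg hu
  have h1 : 2 * Real.log u ≤ Real.log (5 + 2 * u ^ 2) := by
    rw [show 2 * Real.log u = Real.log (u ^ 2) by rw [Real.log_pow]; norm_num]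
    exact Real.log_le_log (by positivity) (by nlinarith)
  have h2 : Real.log u ≤ Real.log (1 + Real.sqrt (9 * Real.pi / 2) * u) :=
    Real.log_le_log hu0 (by nlinarith)
  have h3 : 0 ≤ 1 / (2 * u ^ 2) := by positivity
  rw [gaussMixR]
  calc 4 / 3 + 2 * Real.log u = 2 * (1 / 3) * (2 + 0 + 2 * Real.log u + Real.log u) := by ring
    _ ≤ _ := by gcongr

/-- For fine spacing, u = σ/l is large and Q(1/u) is near 1/2. The penalty is then at least 2 log u
+ 4/3, while the entropy is at most 2 log u + 1. -/
lemma exists_geomBound_nonpos {α σ : ℝ} (hα : 0 < α) (hσ : 0 < σ) :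
    ∃ δ : ℝ, 0 < δ ∧ ∀ l, 0 < l → l < δ → geomBound α σ l ≤ 0 := by
  have hQ : ∀ᶠ x in nhds (0 : ℝ), 1 / 3 < gaussianQ x :=
    continuous_gaussianQ.continuousAt.eventually_const_lt (by rw [gaussianQ_zero]; norm_num)
  obtain ⟨ε, hε, hball⟩ := Metric.eventually_nhds_iff.1 hQ
  set κ := α / (2 * σ) with hκ
  have hκ0 : 0 < κ := by positivity
  -- The first bound makes Q(l/σ) > 1/3; the second gives u ≥ 1 + κ, hence 1 + κu ≤ u².
  refine ⟨min (ε * σ) (σ / (1 + κ)), by positivity, fun l hl hlt => ?_⟩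
  obtain ⟨h1, h2⟩ := lt_min_iff.1 hlt
  set u := σ / l with hu
  have hu0 : 0 < u := by positivity
  have hu1 : 1 + κ ≤ u := by
    rw [lt_div_iff₀ (by positivity)] at h2
    rw [hu, le_div_iff₀ hl]
    linarith
  have hQu : 1 / 3 < gaussianQ (1 / u) := by
    refine hball ?_
    rw [Real.dist_0_eq_abs, abs_of_pos (by positivity), hu, one_div_div, div_lt_iff₀ hσ]
    exact h1
  have hs : α / (2 * l) = κ * u := by rw [hκ, hu]; field_simp
  have hR := le_gaussMixR (by linarith) hQu
  have hH := mul_log_one_add_inv_le (show 0 < α / (2 * l) by positivity)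
  have hlog : Real.log (1 + α / (2 * l)) ≤ 2 * Real.log u := by
    rw [hs, show 2 * Real.log u = Real.log (u ^ 2) by rw [Real.log_pow]; norm_num]
    exact Real.log_le_log (by positivity) (by nlinarith)
  rw [one_div_div] at hH
  rw [geomBound]
  linarith

lemma exists_geomBound_input {σ α l : ℝ} (hσ : 0 < σ) (hα : 0 < α) (hl : 0 < l) :
    ∃ μ : Measure ℝ, IsEquispacedLaw ⊤ l μ ∧ AverageConstraint α μ ∧
      ((geomBound α σ l : ℝ) : EReal) ≤ (channelInfo σ μ : EReal) := by
  obtain ⟨μ, h1, h2, h3, h4⟩ :=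
    exists_geom_input (s := α / (2 * l)) hσ hl (by positivity)
  refine ⟨μ, h1, ⟨h2, ?_⟩, ?_⟩
  · rw [h3]
    apply le_of_eq
    field_simp
  · rwa [one_div_div] at h4

lemma exists_average_input_top {σ α : ℝ} (hσ : 0 < σ) (hα : 0 < α) :
    ∃ (l : ℝ) (μ : Measure ℝ), IsEquispacedLaw ⊤ l μ ∧ NonnegIntensity μ ∧
      AverageConstraint α μ ∧
      (⨆ l' ∈ Ioi (0 : ℝ), ((geomBound α σ l' : ℝ) : EReal))
        ≤ (channelInfo σ μ : EReal) := by
  by_cases h : ∃ l ∈ Ioi (0 : ℝ), 0 < geomBound α σ l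
  · obtain ⟨l₀, hl₀, hpos⟩ := h
    obtain ⟨δ, hδ, hlow⟩ := exists_geomBound_nonpos hα hσ
    obtain ⟨M, hM⟩ := exists_geomBound_lt hα hσ hpos
    have h₁ : δ ≤ l₀ := by
      by_contra! hlt
      exact absurd (hlow l₀ hl₀ hlt) (not_le.2 hpos)
    have h₂ : l₀ ≤ M := by
      by_contra! hlt
      exact lt_irrefl _ (hM l₀ hl₀ hlt)
    have hout : ∀ l ∈ Ioi (0 : ℝ), l ∉ Icc δ M → geomBound α σ l ≤ geomBound α σ l₀ := by
      intro l hl hlC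
      by_cases hlδ : l < δ
      · exact (hlow l hl hlδ).trans hpos.le
      · refine (hM l hl ?_).le
        by_contra! hle
        exact hlC ⟨not_lt.1 hlδ, hle⟩
    obtain ⟨l, hl, hmax⟩ := exists_le_of_isCompact isCompact_Icc
      (fun l hl => hδ.trans_le hl.1)
      ((continuousOn_geomBound hα hσ).mono fun l hl => hδ.trans_le hl.1) ⟨h₁, h₂⟩ hout
    obtain ⟨μ, h1, h2, h3⟩ := exists_geomBound_input hσ hα hl
    refine ⟨_, μ, h1, h1.nonnegIntensity, h2, iSup₂_le fun t ht => le_trans ?_ h3⟩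
    exact_mod_cast hmax t ht
  · push Not at h
    obtain ⟨μ, h1, h2, -⟩ := exists_geomBound_input hσ hα one_pos
    refine ⟨_, μ, h1, h1.nonnegIntensity, h2, iSup₂_le fun t ht => le_trans ?_
      (EReal.coe_ennreal_nonneg _)⟩
    exact_mod_cast h t ht

theorem mainTheorem11 (σ : ℝ) (hσ : 0 < σ) :
    -- peak-intensity constraint, finite `K`
    (∀ K : ℕ, 1 ≤ K →
      ∃ (l : ℝ) (μ : Measure ℝ), IsEquispacedLaw K l μ ∧ NonnegIntensity μ ∧ PeakConstraint μ ∧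
        ((Real.log (K + 1) - gaussMixR (2 * K * σ) : ℝ) : EReal) ≤ (channelInfo σ μ : EReal)) ∧
    -- average-intensity constraint, finite `K`
    (∀ K : ℕ, 1 ≤ K → ∀ α : ℝ, 0 < α →
      ∃ (l : ℝ) (μ : Measure ℝ), IsEquispacedLaw K l μ ∧ NonnegIntensity μ ∧
        AverageConstraint α μ ∧
        (⨆ t ∈ Ioo (0 : ℝ) 1, ((truncGeomBound K α σ t : ℝ) : EReal))
          ≤ (channelInfo σ μ : EReal)) ∧
    -- peak- and average-intensity constraints, finite `K`
    (∀ K : ℕ, 1 ≤ K → ∀ α : ℝ, 0 < α → α < 1 / 2 →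
      ∃ η : ℝ, (η ∈ Ioo (0 : ℝ) 1 ∧ EtaEquation K α η) ∧
        (∀ η' : ℝ, η' ∈ Ioo (0 : ℝ) 1 → EtaEquation K α η' → η' = η) ∧
        ∃ (l : ℝ) (μ : Measure ℝ), IsEquispacedLaw K l μ ∧ NonnegIntensity μ ∧
          PeakConstraint μ ∧ AverageConstraint α μ ∧
          (⨆ t ∈ Ioo (0 : ℝ) η, ((truncGeomBound K α σ t : ℝ) : EReal))
            ≤ (channelInfo σ μ : EReal)) ∧
    -- average-intensity constraint, `K = ∞`
    (∀ α : ℝ, 0 < α →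
      ∃ (l : ℝ) (μ : Measure ℝ), IsEquispacedLaw ⊤ l μ ∧ NonnegIntensity μ ∧
        AverageConstraint α μ ∧
        (⨆ l' ∈ Ioi (0 : ℝ), ((geomBound α σ l' : ℝ) : EReal))
          ≤ (channelInfo σ μ : EReal)) := by
  exact ⟨fun K hK => exists_peak_input hσ hK, fun K hK α hα => exists_average_input hσ hα hK,
    fun K hK α hα hα2 => exists_peak_average_input hσ hα hα2 hK,
    fun α hα => exists_average_input_top hσ hα⟩
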